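/- Let $Q=(V,E,r,s)$ be a finite directed graph (loops and multiple edges allowed) with $n=|V|$ vertices, $\alpha$ loop edges (edges with $s(e)=r(e)$) and $\beta$ non-loop edges. A contractive representation of $Q$ on a complex Hilbert space assigns to each vertex $v$ an orthogonal projection $P_v$ (no orthogonality between different $P_v$ is required) and to each edge $e$ a contraction $T_e$ with $P_{r(e)}T_e=T_e=T_eP_{s(e)}$. Let $OA(Q)$ be the universal operator algebra of $Q$, that is, the norm-closed, not necessarily unital algebra generated by the $P_v$ and $T_e$ in the universal contractive representation of $Q$, and let $GC^*_m(Q)$ be the $C^*$-algebra generated by the same elements (the universal $C^*$-algebra of $Q$). For a Banach algebra $A$ let $M_A$ be its maximal ideal space, i.e. the set of nonzero multiplicative linear functionals with the weak-$*$ topology. For nonempty $S\subseteq V$ let $n(S)$ be the number of edges $e$ with $r(e),s(e)\in S$, and let $\overline{\mathbb D}^k$ be the product of $k$ closed unit discs of $\mathbb C$ (a point if $k=0$). Then $\alpha$ and $\beta$ are uniquely determined by the topological space $M_{OA(Q)}$, and they can be calculated from it as follows. 1. The connected components of $M_{OA(Q)}$ correspond bijectively to the nonempty subsets $S\subseteq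 V$ in such a way that the component of $S$ is homeomorphic to $\overline{\mathbb D}^{k}$ if and only if $k=n(S)$. 2. $\alpha\,2^{n-1}+\beta\,2^{n-2}=\sum_{\emptyset\ne S\subseteq V} n(S)$. 3. $(\alpha,\beta)$ is the only pair $(a,b)$ of natural numbers such that $a+b=\max_S n(S)$ (read as $0$ if $V=\emptyset$) and $a\,2^{n-1}+b\,2^{n-2}=\sum_{\emptyset\ne S\subseteq V} n(S)$. 4. If $Q'$ is another finite directed graph and $M_{OA(Q)}$ is homeomorphic to $M_{OA(Q')}$, then $Q$ and $Q'$ have the same number of loop edges and the same number of non-loop edges. The same holds with $GC^*_m(Q)$ (and $GC^*_m(Q')$) in place of $OA(Q)$ (and $OA(Q')$). -/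

import Mathlib

open scoped ENNReal

universe u v u' v'

/-- A directed graph with vertex set `V` and edge set `E` (loops and multiple edges allowed). -/
structure DirGraph (V : Type u) (E : Type v) where
  /-- the range map -/
  r : E → V
  /-- the source map -/
  s : E → V

namespace DirGraph

variable {V : Type u} {E : Type v}

/-- The number of loop edges, i.e. edges `e` with `s e = r e`. -/
noncomputable def numLoops (Q : DirGraph V E) : ℕ := Nat.card {e : E // Q.s e = Q.r e}

/-- The number of non-loop edges. -/
noncomputable def numNonLoops (Q : DirGraph V E) : ℕ := Nat.card {e : E // Q.s e ≠ Q.r e}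

/-- `n(S)`, the number of edges with both range and source in `S`. -/
noncomputable def n (Q : DirGraph V E) (S : Finset V) : ℕ :=
  Nat.card {e : E // Q.r e ∈ S ∧ Q.s e ∈ S}

/-- A contractive representation of `Q` on a complex Hilbert space `H`: every vertex goes to an
orthogonal projection (the projections of different vertices need not be orthogonal to each
other) and every edge `e` to a contraction `T e` with `P (r e) * T e = T e = T e * P (s e)`. -/
structure Rep (Q : DirGraph V E) : Type (max u v + 1) where
  H : Type (max u v)
  [normedAddCommGroup : NormedAddCommGroup H]
  [innerProductSpace : InnerProductSpace ℂ H]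
  [completeSpace : CompleteSpace H]
  P : V → (H →L[ℂ] H)
  T : E → (H →L[ℂ] H)
  isStarProjection_P : ∀ v, IsStarProjection (P v)
  norm_T_le : ∀ e, ‖T e‖ ≤ 1
  P_mul_T : ∀ e, P (Q.r e) * T e = T e
  T_mul_P : ∀ e, T e * P (Q.s e) = T e

attribute [instance] Rep.normedAddCommGroup Rep.innerProductSpace Rep.completeSpace

/-- The C⋆-algebra of all bounded families `(x π)`, `x π` a bounded operator on the space of `π`,
indexed by all contractive representations `π` of `Q`, with the supremum norm. Its elements act
on the Hilbert direct sum of all representation spaces. -/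
abbrev Ambient (Q : DirGraph V E) : Type (max u v + 1) :=
  lp (fun π : Q.Rep => π.H →L[ℂ] π.H) ∞

/-- The vertex projection `P_v` in the universal representation. -/
noncomputable def univP (Q : DirGraph V E) (v : V) : Q.Ambient :=
  ⟨fun π => π.P v, memℓp_infty ⟨1, by
    rintro _ ⟨π, rfl⟩
    exact (π.isStarProjection_P v).norm_le⟩⟩

/-- The edge contraction `T_e` in the universal representation. -/
noncomputable def univT (Q : DirGraph V E) (e : E) : Q.Ambient :=
  ⟨fun π => π.T e, memℓp_infty ⟨1, by
    rintro _ ⟨π, rfl⟩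
    exact π.norm_T_le e⟩⟩

/-- The universal operator algebra `OA(Q)`: the norm closure of the (not necessarily unital)
algebra generated by the `P_v` and `T_e` in the universal representation. Equivalently, the
completion of the algebra of words in vertices and edges, modulo the relations
`r(e) e = e = e s(e)` and `v v = v`, in the supremum of the seminorms `‖π(x)‖` over all
contractive representations `π`. -/
noncomputable def OA (Q : DirGraph V E) : NonUnitalSubalgebra ℂ Q.Ambient :=
  (NonUnitalAlgebra.adjoin ℂ (Set.range Q.univP ∪ Set.range Q.univT)).topologicalClosure

/-- The universal C⋆-algebra `GC*_m(Q)`: the (not necessarily unital) C⋆-algebra generated by the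
`P_v` and `T_e` in the universal representation. -/
noncomputable def GC (Q : DirGraph V E) : NonUnitalStarSubalgebra ℂ Q.Ambient :=
  (NonUnitalStarAlgebra.adjoin ℂ (Set.range Q.univP ∪ Set.range Q.univT)).topologicalClosure

/-- The maximal ideal space of `OA(Q)`: the nonzero multiplicative linear functionals with the
weak-⋆ topology. -/
abbrev MOA (Q : DirGraph V E) : Type (max u v + 1) := WeakDual.characterSpace ℂ Q.OA

/-- The maximal ideal space of `GC*_m(Q)`. -/
abbrev MGC (Q : DirGraph V E) : Type (max u v + 1) := WeakDual.characterSpace ℂ Q.GC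

end DirGraph

/-- The product of `k` copies of the closed unit disc of `ℂ` (a point for `k = 0`). -/
abbrev PolyDisc (k : ℕ) : Type := Fin k → Metric.closedBall (0 : ℂ) 1

/-- The connected component `C` of `X` as a subspace of `X`. -/
abbrev componentSpace {X : Type u} [TopologicalSpace X] (C : ConnectedComponents X) : Type u :=
  ((ConnectedComponents.mk : X → ConnectedComponents X) ⁻¹' {C} : Set X)

/-! A character sends each idempotent $P_v$ to 0 or 1. Let $S$ be the set of vertices with value 1.
It is nonempty, the relations force $T_e \mapsto 0$ unless both ends of $e$ lie in $S$, and the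
remaining values lie in the closed disc. Conversely, any such data is a one-dimensional contractive
representation, hence a character. Adding adjoints creates no new characters, since a character of a
C⋆-algebra preserves the involution. So both maximal ideal spaces are the disjoint union over $S
\neq \emptyset$ of $\overline{\mathbb D}^{n(S)}$ (`nonempty_homeomorph_MOA`,
`nonempty_homeomorph_MGC`).

The summands are connected, so they are the components. That $n(S)$ can be read off from a component
is invariance of dimension for polydiscs (`PolyDisc.eq_of_homeomorph`), obtained from an analytic
proof of a Brouwer-type zero theorem.

Counting pairs $(e, S)$ with both ends of $e$ in $S$ gives $\alpha 2^{n-1} + \beta 2^{n-2}$, and $S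
= V$ gives $\alpha + \beta$. These two equations are independent, and $n$ is known because there are
$2^n - 1$ components. -/

/-! ### Change of variables that is polynomial in a parameter -/

open MeasureTheory in
/-- The integral of a family of polynomials of bounded degree is a polynomial in the parameter. -/
theorem exists_polynomial_integral_eval {X : Type*} [MeasurableSpace X] (μ : Measure X)
    (p : X → Polynomial ℝ) (d : ℕ) (hd : ∀ x, (p x).natDegree ≤ d)
    (hint : ∀ t, Integrable (fun x => (p x).eval t) μ) :
    ∃ q : Polynomial ℝ, ∀ t, ∫ x, (p x).eval t ∂μ = q.eval t := by
  classical
  have hinj : Set.InjOn (fun i : ℕ => (i : ℝ)) (Finset.range (d + 1)) :=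
    fun a _ b _ h => Nat.cast_injective h
  refine ⟨Lagrange.interpolate (Finset.range (d + 1)) (fun i : ℕ => (i : ℝ))
    (fun i => ∫ x, (p x).eval (i : ℝ) ∂μ), fun t => ?_⟩
  -- Writing the polynomial through its values at the nodes 0, …, d lets integrability of those
  -- values do all the work; the coefficients never need to be integrated.
  have h (x : X) : (p x).eval t = ∑ i ∈ Finset.range (d + 1), (p x).eval (i : ℝ) *
      (Lagrange.basis (Finset.range (d + 1)) (fun i : ℕ => (i : ℝ)) i).eval t := by
    conv_lhs => rw [Lagrange.eq_interpolate (f := p x) hinj (by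
      rw [Finset.card_range]
      exact (Polynomial.degree_le_of_natDegree_le (hd x)).trans_lt
        (by exact_mod_cast Nat.lt_succ_self d))]
    simp [Lagrange.interpolate_apply, Polynomial.eval_finsetSum]
  simp_rw [h]
  rw [integral_finsetSum (f := fun (i : ℕ) x => (p x).eval (i : ℝ) *
    (Lagrange.basis (Finset.range (d + 1)) (fun i : ℕ => (i : ℝ)) i).eval t)
    _ fun i _ => (hint i).mul_const _]
  simp [Lagrange.interpolate_apply, Polynomial.eval_finsetSum, integral_mul_const]

theorem exists_polynomial_det_one_add_smul {E : Type*} [NormedAddCommGroup E] [NormedSpace ℝ E]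
    [FiniteDimensional ℝ E] (A : E →L[ℝ] E) :
    ∃ p : Polynomial ℝ, p.natDegree ≤ Module.finrank ℝ E ∧
      ∀ t : ℝ, p.eval t = (1 + t • A).det := by
  classical
  set b := Module.finBasis ℝ E
  set M := LinearMap.toMatrix b b (A : E →ₗ[ℝ] E)
  refine ⟨((Polynomial.X : Polynomial ℝ) • M.map Polynomial.C
    + (1 : Matrix _ _ ℝ).map Polynomial.C).det, ?_, fun t => ?_⟩
  · simpa using Polynomial.natDegree_det_X_add_C_le M 1
  · rw [ContinuousLinearMap.det, ← LinearMap.det_toMatrix b, ← Polynomial.coe_evalRingHom,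
      RingHom.map_det]
    congr 1
    have : ((1 + t • A : E →L[ℝ] E) : E →ₗ[ℝ] E) = 1 + t • (A : E →ₗ[ℝ] E) := rfl
    rw [this, (LinearMap.toMatrix b b).map_add, (LinearMap.toMatrix b b).map_smul,
      LinearMap.toMatrix_one, add_comm]
    ext i j
    simp [Matrix.map_apply, M, Matrix.one_apply, apply_ite]
    ring

section

open MeasureTheory Metric

theorem image_closedBall_of_injective_of_surjective {E : Type*} [NormedAddCommGroup E] {f : E → E} {R : ℝ}
    (hinj : f.Injective) (hsurj : f.Surjective)
    (hf : ∀ x, R ≤ ‖x‖ → f x = x) : f '' closedBall 0 R = closedBall 0 R := by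
  ext y
  constructor
  · rintro ⟨x, hx, rfl⟩
    by_contra h
    have h' : R ≤ ‖f x‖ := by
      rw [mem_closedBall_zero_iff, not_le] at h
      exact h.le
    exact h ((hinj (hf _ h')).symm ▸ hx)
  · intro hy
    obtain ⟨x, rfl⟩ := hsurj y
    by_cases hx : x ∈ closedBall (0 : E) R
    · exact ⟨x, hx, rfl⟩
    · rw [mem_closedBall_zero_iff, not_le] at hx
      rw [hf x hx.le] at hy ⊢
      exact ⟨x, hy, hf x hx.le⟩

variable {E : Type*} [NormedAddCommGroup E] [NormedSpace ℝ E] [FiniteDimensional ℝ E]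

theorem bijective_add_of_lipschitzWith {u : E → E} {K : NNReal} (hu : LipschitzWith K u)
    (hK : K < 1) : Function.Bijective fun x => x + u x := by
  have h : ApproximatesLinearOn (fun x => x + u x)
      ((ContinuousLinearEquiv.refl ℝ E : E ≃L[ℝ] E) : E →L[ℝ] E) Set.univ K := by
    intro x _ y _
    have := hu.norm_sub_le x y
    simpa [add_sub_add_comm] using this
  have hc : Subsingleton E ∨
      K < ‖((ContinuousLinearEquiv.refl ℝ E).symm : E →L[ℝ] E)‖₊⁻¹ := by
    rcases subsingleton_or_nontrivial E with hE | hE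
    · exact .inl hE
    · right
      simpa using hK
  exact (h.toHomeomorph _ hc).bijective

variable [MeasurableSpace E] [BorelSpace E] (μ : Measure E) [μ.IsAddHaarMeasure]

/-- For small `t` the map `x + t • u x` is a bijection of the ball with positive Jacobian, so this
is the change of variables formula without absolute value. -/
theorem exists_integral_comp_add_smul_mul_det {u : E → E} (hu : ContDiff ℝ 1 u) {R : ℝ}
    (hR : ∀ x, R ≤ ‖x‖ → u x = 0) :
    ∃ ε > 0, ∀ t : ℝ, |t| < ε → ∀ g : E → ℝ,
      ∫ x in closedBall 0 R, g (x + t • u x) * (1 + t • fderiv ℝ u x).det ∂μ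
        = ∫ x in closedBall 0 R, g x ∂μ := by
  have hsupp : HasCompactSupport u :=
    HasCompactSupport.intro (isCompact_closedBall 0 R) fun x hx => hR x (by
      rw [mem_closedBall_zero_iff, not_le] at hx
      exact hx.le)
  obtain ⟨K, hK⟩ := hu.lipschitzWith_of_hasCompactSupport hsupp one_ne_zero
  have hdet : ∃ δ > 0, ∀ A : E →L[ℝ] E, ‖A‖ < δ → 0 < (1 + A).det := by
    have hc : Continuous fun A : E →L[ℝ] E => (1 + A).det :=
      ContinuousLinearMap.continuous_det.comp (continuous_const.add continuous_id)
    have h0 : (0 : ℝ) < (1 + (0 : E →L[ℝ] E)).det := by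
      have : (1 + (0 : E →L[ℝ] E)).det = 1 := by
        rw [add_zero]; exact LinearMap.det_id
      rw [this]; exact one_pos
    obtain ⟨δ, hδ, h⟩ := Metric.eventually_nhds_iff.1 (hc.continuousAt.eventually_const_lt h0)
    exact ⟨δ, hδ, fun A hA => h (by simpa using hA)⟩
  obtain ⟨δ, hδ, hdet⟩ := hdet
  -- The bound `δ` keeps the Jacobian positive, the bound 1 makes `t • u` a contraction, and `K + 1`
  -- avoids division by zero.
  refine ⟨min δ 1 / (K + 1), by positivity, fun t ht g => ?_⟩
  rw [lt_div_iff₀ (by positivity)] at ht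
  have ht' : |t| * K < min δ 1 := by nlinarith [abs_nonneg t]
  have hL : LipschitzWith (‖t‖₊ * K) fun x => t • u x := by
    refine LipschitzWith.of_dist_le_mul fun x y => ?_
    rw [dist_smul₀]
    simp only [NNReal.coe_mul, coe_nnnorm, mul_assoc]
    gcongr
    exact hK.dist_le_mul x y
  have hbij := bijective_add_of_lipschitzWith hL (by
    rw [← NNReal.coe_lt_coe]
    simpa using ht'.trans_le (min_le_right _ _))
  have himg := image_closedBall_of_injective_of_surjective (R := R) hbij.1 hbij.2
    (fun x hx => by simp [hR x hx])
  have hder (x : E) : HasFDerivAt (fun x => x + t • u x) (1 + t • fderiv ℝ u x) x :=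
    (hasFDerivAt_id x).add (((hu.differentiable one_ne_zero) x).hasFDerivAt.const_smul t)
  have hcv := integral_image_eq_integral_abs_det_fderiv_smul μ
    (measurableSet_closedBall (x := (0 : E)) (ε := R))
    (fun x _ => (hder x).hasFDerivWithinAt) hbij.1.injOn g
  rw [himg] at hcv
  rw [hcv]
  refine setIntegral_congr_fun measurableSet_closedBall fun x _ => ?_
  have hpos : 0 < (1 + t • fderiv ℝ u x).det := by
    refine hdet _ ?_
    rw [norm_smul, Real.norm_eq_abs]
    refine lt_of_le_of_lt ?_ (ht'.trans_le (min_le_left _ _))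
    gcongr
    exact norm_fderiv_le_of_lipschitz ℝ hK
  simp only [abs_of_pos hpos, smul_eq_mul, mul_comm]

end

section

open MeasureTheory Metric

variable {E : Type*} [NormedAddCommGroup E] [InnerProductSpace ℝ E] [FiniteDimensional ℝ E]
  [MeasurableSpace E] [BorelSpace E] (μ : Measure E) [μ.IsAddHaarMeasure]

/-- With `t • u` in place of `u`, the left side is a polynomial in `t`, because the weight is a
polynomial in the squared norm. It is constant for small `t`, hence also at `t = 1`, where the map
need not be injective. -/
theorem integral_one_sub_norm_sq_pow_mul_det {u : E → E} (hu : ContDiff ℝ 1 u) {R : ℝ}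
    (hR : ∀ x, R ≤ ‖x‖ → u x = 0) (c : ℝ) (N : ℕ) :
    ∫ x in closedBall 0 R, (1 - c * ‖x + u x‖ ^ 2) ^ N * (1 + fderiv ℝ u x).det ∂μ
        = ∫ x in closedBall 0 R, (1 - c * ‖x‖ ^ 2) ^ N ∂μ := by
  obtain ⟨ε, hε, h⟩ := exists_integral_comp_add_smul_mul_det μ hu hR
  choose p hpd hp using fun x => exists_polynomial_det_one_add_smul (fderiv ℝ u x)
  let s : E → Polynomial ℝ := fun x => 1 - Polynomial.C c * (Polynomial.C (‖x‖ ^ 2)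
    + Polynomial.C (2 * inner ℝ x (u x)) * Polynomial.X
    + Polynomial.C (‖u x‖ ^ 2) * Polynomial.X ^ 2)
  have hs (x : E) (t : ℝ) : (s x).eval t = 1 - c * ‖x + t • u x‖ ^ 2 := by
    simp only [s, Polynomial.eval_sub, Polynomial.eval_one, Polynomial.eval_mul,
      Polynomial.eval_C, Polynomial.eval_add, Polynomial.eval_X, Polynomial.eval_pow,
      norm_add_sq_real, inner_smul_right, norm_smul, mul_pow, Real.norm_eq_abs, sq_abs]
    ring
  have hsd (x : E) : (s x).natDegree ≤ 2 := by
    simp only [s]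
    compute_degree
  have hF (t : ℝ) (x : E) : (s x ^ N * p x).eval t
      = (1 - c * ‖x + t • u x‖ ^ 2) ^ N * (1 + t • fderiv ℝ u x).det := by
    rw [Polynomial.eval_mul, Polynomial.eval_pow, hs, hp]
  have hcont (t : ℝ) : Continuous fun x =>
      (1 - c * ‖x + t • u x‖ ^ 2) ^ N * (1 + t • fderiv ℝ u x).det := by
    have h1 := hu.continuous
    have h2 : Continuous fun x => (1 + t • fderiv ℝ u x).det :=
      ContinuousLinearMap.continuous_det.comp
        (continuous_const.add ((hu.continuous_fderiv one_ne_zero).const_smul t))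
    fun_prop
  obtain ⟨q, hq⟩ := exists_polynomial_integral_eval (μ.restrict (closedBall 0 R))
    (fun x => s x ^ N * p x) (N * 2 + Module.finrank ℝ E)
    (fun x => Polynomial.natDegree_mul_le.trans (add_le_add
      (Polynomial.natDegree_pow_le.trans (Nat.mul_le_mul_left _ (hsd x))) (hpd x)))
    (fun t => by
      simp_rw [hF]
      exact (hcont t).continuousOn.integrableOn_compact (isCompact_closedBall _ _))
  simp_rw [hF] at hq
  have hqc : q = Polynomial.C (∫ x in closedBall 0 R, (1 - c * ‖x‖ ^ 2) ^ N ∂μ) := by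
    refine Polynomial.eq_of_infinite_eval_eq _ _
      ((Set.Ioo_infinite (neg_lt_self hε)).mono fun t ht => ?_)
    change q.eval t = _
    rw [← hq t, Polynomial.eval_C]
    exact h t (abs_lt.2 ht) fun x => (1 - c * ‖x‖ ^ 2) ^ N
  have h1 := hq 1
  simpa [hqc] using h1

end

/-! ### Zeros of maps close to the identity and invariance of dimension -/

section

open MeasureTheory Metric Filter Topology

variable {E : Type*} [NormedAddCommGroup E] [InnerProductSpace ℝ E] [FiniteDimensional ℝ E]

/-- If `x + u x` stayed at distance at least `δ` from 0, the weight along it would be at most `a ^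
N`, while on the ball of radius `δ / 2` the weight itself is at least `b ^ N` with `a < b`. The
equality of integrals then fails for large `N`. -/
theorem exists_add_eq_zero_of_contDiff {u : E → E} (hu : ContDiff ℝ 1 u) {R : ℝ} (hR0 : 0 < R)
    (hR : ∀ x, R ≤ ‖x‖ → u x = 0) : ∃ x, x + u x = 0 := by
  borelize E
  by_contra! hne
  have hc : Continuous fun x => ‖x + u x‖ := by
    have := hu.continuous
    fun_prop
  have hB := isCompact_closedBall (0 : E) R
  have hBne : (closedBall (0 : E) R).Nonempty := ⟨0, by simp [hR0.le]⟩
  obtain ⟨x₀, -, hx₀⟩ := hB.exists_isMinOn hBne hc.continuousOn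
  obtain ⟨M₀, hM₀⟩ := hB.exists_bound_of_continuousOn hc.continuousOn
  have hcd : Continuous fun x => (1 + fderiv ℝ u x).det :=
    ContinuousLinearMap.continuous_det.comp
      (continuous_const.add (hu.continuous_fderiv one_ne_zero))
  obtain ⟨C, hC⟩ := hB.exists_bound_of_continuousOn hcd.continuousOn
  set δ := min ‖x₀ + u x₀‖ R
  have hδ : 0 < δ := lt_min (norm_pos_iff.2 (hne x₀)) hR0
  set M := max M₀ R
  have hM : 0 < M := hR0.trans_le (le_max_right _ _)
  have hδM : δ ≤ M := (min_le_right _ _).trans (le_max_right _ _)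
  -- This scaling keeps the base `1 - c * ‖y‖ ^ 2` nonnegative for all `y` of norm at most `M`,
  -- which covers both the ball and its image.
  set c := (M ^ 2)⁻¹
  have hc0 : 0 < c := by positivity
  have hcM {y : ℝ} (hy0 : 0 ≤ y) (hy : y ≤ M) : c * y ^ 2 ≤ 1 := by
    have : y ^ 2 ≤ M ^ 2 := by gcongr
    calc c * y ^ 2 ≤ c * M ^ 2 := by gcongr
      _ = 1 := inv_mul_cancel₀ (by positivity)
  set a := 1 - c * δ ^ 2
  set b := 1 - c * (δ / 2) ^ 2
  have ha0 : 0 ≤ a := sub_nonneg.2 (hcM hδ.le hδM)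
  have hab : a < b := by
    have : 0 < c * δ ^ 2 := by positivity
    simp only [a, b]
    nlinarith
  have hb0 : 0 < b := ha0.trans_lt hab
  set μ : Measure E := volume
  have hfin : μ (closedBall 0 R) < ∞ := hB.measure_lt_top
  have hkey (N : ℕ) : b ^ N * μ.real (closedBall 0 (δ / 2))
      ≤ a ^ N * C * μ.real (closedBall 0 R) := by
    have hlow : b ^ N * μ.real (closedBall 0 (δ / 2))
        ≤ ∫ x in closedBall 0 R, (1 - c * ‖x‖ ^ 2) ^ N ∂μ := by
      have hint : IntegrableOn (fun x : E => (1 - c * ‖x‖ ^ 2) ^ N) (closedBall 0 R) μ :=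
        ContinuousOn.integrableOn_compact hB (by fun_prop)
      have hsub : closedBall (0 : E) (δ / 2) ⊆ closedBall 0 R :=
        closedBall_subset_closedBall (by linarith [min_le_right ‖x₀ + u x₀‖ R])
      calc b ^ N * μ.real (closedBall 0 (δ / 2))
          = ∫ x in closedBall (0 : E) (δ / 2), b ^ N ∂μ := by
            rw [setIntegral_const, smul_eq_mul, mul_comm]
        _ ≤ ∫ x in closedBall (0 : E) (δ / 2), (1 - c * ‖x‖ ^ 2) ^ N ∂μ := by
            refine setIntegral_mono_on (integrableOn_const
              (isCompact_closedBall _ _).measure_lt_top.ne) (hint.mono_set hsub)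
              measurableSet_closedBall fun x hx => ?_
            rw [mem_closedBall_zero_iff] at hx
            simp only [b]
            gcongr
        _ ≤ _ := by
            refine setIntegral_mono_set hint ?_ hsub.eventuallyLE
            filter_upwards [ae_restrict_mem measurableSet_closedBall] with x hx
            rw [mem_closedBall_zero_iff] at hx
            exact pow_nonneg (sub_nonneg.2
              (hcM (norm_nonneg _) (hx.trans (le_max_right _ _)))) _
    refine hlow.trans ?_
    rw [← integral_one_sub_norm_sq_pow_mul_det μ hu hR c N]
    refine (Real.le_norm_self _).trans (norm_setIntegral_le_of_norm_le_const hfin fun x hx => ?_)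
    rw [norm_mul, norm_pow]
    have h1 : δ ≤ ‖x + u x‖ := (min_le_left _ _).trans (hx₀ hx)
    have h2 : ‖x + u x‖ ≤ M := by
      have := hM₀ x hx
      rw [norm_norm] at this
      exact this.trans (le_max_left _ _)
    gcongr
    · rw [Real.norm_of_nonneg (sub_nonneg.2 (hcM (norm_nonneg _) h2))]
      simp only [a]
      gcongr
    · exact hC x hx
  have hv : 0 < μ.real (closedBall (0 : E) (δ / 2)) :=
    ENNReal.toReal_pos (measure_closedBall_pos μ _ (by positivity)).ne'
      (isCompact_closedBall _ _).measure_lt_top.ne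
  have hlim : Tendsto (fun N : ℕ => (a / b) ^ N * (C * μ.real (closedBall 0 R))) atTop (𝓝 0) := by
    simpa using (tendsto_pow_atTop_nhds_zero_of_lt_one (by positivity)
      ((div_lt_one hb0).2 hab)).mul_const (C * μ.real (closedBall 0 R))
  refine hv.not_ge (ge_of_tendsto' hlim fun N => ?_)
  rw [div_pow, div_mul_eq_mul_div, le_div_iff₀ (by positivity), ← mul_assoc]
  linarith [hkey N]

/-- A smooth approximation `g` of `G` is glued to the identity near the unit sphere, and the glued
map has a zero. In the gluing zone the displacement is at most 1/4 + 1/2 < 7/8, so the zero lies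
where the glued map is `g`. There `G` would be smaller than its minimum norm. -/
theorem exists_eq_zero_of_norm_sub_le {G : E → E} (hG : Continuous G)
    (h : ∀ x ∈ closedBall (0 : E) 1, ‖G x - x‖ ≤ 1 / 2) : ∃ x ∈ closedBall (0 : E) 1, G x = 0 := by
  by_contra! hne
  obtain ⟨x₀, hx₀, hmin⟩ := (isCompact_closedBall (0 : E) 1).exists_isMinOn ⟨0, by simp⟩
    hG.norm.continuousOn
  have hδ : 0 < ‖G x₀‖ := norm_pos_iff.2 (hne x₀ hx₀)
  obtain ⟨g, hg, hgG, -⟩ := hG.exists_contDiff_approx 1 (ε := fun _ => min ‖G x₀‖ (1 / 4))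
    continuous_const (fun _ => by positivity)
  let χ : ContDiffBump (0 : E) := ⟨7 / 8, 1, by norm_num, by norm_num⟩
  have hu : ContDiff ℝ 1 fun x => χ x • (g x - x) :=
    χ.contDiff.smul ((hg.of_le (by simp)).sub contDiff_id)
  obtain ⟨x, hx⟩ := exists_add_eq_zero_of_contDiff hu one_pos fun x hx => by
    rw [χ.zero_of_le_dist (by simpa using hx), zero_smul]
  rcases le_total 1 ‖x‖ with h1 | h1
  · rw [χ.zero_of_le_dist (by simpa using h1), zero_smul, add_zero] at hx
    norm_num [hx] at h1
  have hxB : x ∈ closedBall (0 : E) 1 := by simpa using h1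
  have hgx := hgG x
  rw [dist_eq_norm] at hgx
  rcases le_total ‖x‖ (7 / 8) with h2 | h2
  · rw [χ.one_of_mem_closedBall (by simpa using h2), one_smul, add_sub_cancel] at hx
    rw [hx, zero_sub, norm_neg] at hgx
    exact (hgx.trans_le (min_le_left _ _)).not_ge (hmin hxB)
  · have h3 : ‖χ x • (g x - x)‖ ≤ 3 / 4 := by
      rw [norm_smul, Real.norm_of_nonneg χ.nonneg]
      calc χ x * ‖g x - x‖ ≤ 1 * ‖g x - x‖ := by gcongr; exact χ.le_one
        _ = ‖(g x - G x) + (G x - x)‖ := by rw [one_mul]; congr 1; abel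
        _ ≤ 1 / 4 + 1 / 2 :=
          (norm_add_le _ _).trans (add_le_add (hgx.le.trans (min_le_right _ _)) (h x hxB))
        _ = 3 / 4 := by norm_num
    rw [← neg_eq_iff_add_eq_zero.2 hx, norm_neg] at h3
    linarith

/-- An injective `f` is a closed embedding, so its inverse extends to all of `F`. A smooth
approximation `g` of that extension misses points arbitrarily close to 0 because `F` has smaller
dimension. Yet `g ∘ f` is close to the identity, and so is its shift by a missed value `c`, which
must therefore vanish somewhere. -/
theorem not_injective_of_finrank_lt {F : Type*} [NormedAddCommGroup F] [NormedSpace ℝ F]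
    [FiniteDimensional ℝ F] (hEF : Module.finrank ℝ F < Module.finrank ℝ E)
    {f : closedBall (0 : E) 1 → F} (hf : Continuous f) : ¬ f.Injective := by
  intro hinj
  have : CompactSpace (closedBall (0 : E) 1) :=
    isCompact_iff_compactSpace.1 (isCompact_closedBall _ _)
  obtain ⟨H, hH⟩ := ContinuousMap.exists_extension
    (isClosed_closedBall (x := (0 : E)) (ε := 1)).isClosedEmbedding_subtypeVal
    (⟨f, hf⟩ : C(closedBall (0 : E) 1, F))
  obtain ⟨k, hk⟩ := ContinuousMap.exists_extension (hf.isClosedEmbedding hinj)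
    (⟨Subtype.val, continuous_subtype_val⟩ : C(closedBall (0 : E) 1, E))
  obtain ⟨g, hg, hgk, -⟩ := k.continuous.exists_contDiff_approx 1 (ε := fun _ => 1 / 4)
    continuous_const (fun _ => by norm_num)
  obtain ⟨c, hcr, hc⟩ := (ContDiff.dense_compl_range_of_finrank_lt_finrank
    (hg.of_le (by simp)) hEF).exists_dist_lt 0 (ε := 1 / 4) (by norm_num)
  rw [dist_zero_left] at hc
  obtain ⟨x, -, hx⟩ := exists_eq_zero_of_norm_sub_le (G := fun x => g (H x) - c)
    ((hg.continuous.comp H.continuous).sub continuous_const) fun x hx => by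
      have h1 : H x = f ⟨x, hx⟩ := DFunLike.congr_fun hH ⟨x, hx⟩
      have h2 : k (f ⟨x, hx⟩) = x := DFunLike.congr_fun hk ⟨x, hx⟩
      have h3 := hgk (f ⟨x, hx⟩)
      rw [h2, dist_eq_norm] at h3
      calc ‖g (H x) - c - x‖ = ‖(g (f ⟨x, hx⟩) - x) - c‖ := by rw [h1]; congr 1; abel
        _ ≤ 1 / 4 + 1 / 4 := (norm_sub_le _ _).trans (add_le_add h3.le hc.le)
        _ = 1 / 2 := by norm_num
  exact hcr ⟨H x, sub_eq_zero.1 hx⟩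

theorem PolyDisc.le_of_homeomorph {j k : ℕ} (h : PolyDisc k ≃ₜ PolyDisc j) : k ≤ j := by
  by_contra! hjk
  -- The Euclidean unit ball of `ℂ ^ k` sits inside the polydisc, which brings in the inner product
  -- used for balls.
  let ι : closedBall (0 : PiLp 2 fun _ : Fin k => ℂ) 1 → PolyDisc k := fun x i =>
    ⟨x.1 i, by
      rw [mem_closedBall_zero_iff]
      exact (PiLp.norm_apply_le x.1 i).trans (mem_closedBall_zero_iff.1 x.2)⟩
  have hι : Continuous ι := by fun_prop
  have hιi : ι.Injective := fun x y hxy => by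
    ext i
    exact congrArg Subtype.val (congrFun hxy i)
  refine not_injective_of_finrank_lt (E := PiLp 2 fun _ : Fin k => ℂ) (F := Fin j → ℂ) ?_
    (f := fun x i => ((h (ι x) i : closedBall (0 : ℂ) 1) : ℂ)) ?_ fun x y hxy => ?_
  · rw [(WithLp.linearEquiv 2 ℝ (Fin k → ℂ)).finrank_eq]
    simpa [Module.finrank_pi_fintype] using hjk
  · fun_prop
  · refine hιi (h.injective ?_)
    ext i
    exact congrFun hxy i

theorem PolyDisc.eq_of_homeomorph {j k : ℕ} (h : PolyDisc k ≃ₜ PolyDisc j) : k = j :=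
  (PolyDisc.le_of_homeomorph h).antisymm (PolyDisc.le_of_homeomorph h.symm)

end

/-! ### One-dimensional representations and the characters they define -/

namespace DirGraph

open Metric WeakDual

variable {V : Type u} {E : Type v} (Q : DirGraph V E)

/-- The points of the maximal ideal spaces: a nonempty set `S` of vertices together with a point of
the closed unit disc for every edge within `S`. -/
abbrev CharParam : Type (max u v) :=
  Σ S : {S : Finset V // S.Nonempty},
    ({e : E // Q.r e ∈ S.1 ∧ Q.s e ∈ S.1} → closedBall (0 : ℂ) 1)

variable {Q}

open Classical in
/-- The value of the character with parameter `p` at the vertex `v`. -/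
noncomputable def CharParam.vertex (p : Q.CharParam) (v : V) : ℂ := if v ∈ p.1.1 then 1 else 0

open Classical in
/-- The value of the character with parameter `p` at the edge `e`. -/
noncomputable def CharParam.edge (p : Q.CharParam) (e : E) : ℂ :=
  if h : Q.r e ∈ p.1.1 ∧ Q.s e ∈ p.1.1 then (p.2 ⟨e, h⟩ : ℂ) else 0

theorem CharParam.ext_vertex_edge {p q : Q.CharParam} (hv : ∀ v, p.vertex v = q.vertex v)
    (he : ∀ e, p.edge e = q.edge e) : p = q := by
  obtain ⟨⟨S, hS⟩, z⟩ := p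
  obtain ⟨⟨S', hS'⟩, z'⟩ := q
  obtain rfl : S = S' := by
    ext v
    have := hv v
    by_cases h : v ∈ S <;> by_cases h' : v ∈ S' <;> simp_all [CharParam.vertex]
  congr 1
  funext e
  have := he e.1
  simp only [CharParam.edge, dif_pos e.2] at this
  exact Subtype.ext this

theorem CharParam.continuous_vertex (v : V) :
    Continuous fun p : Q.CharParam => p.vertex v := by
  classical
  exact continuous_sigma fun S => continuous_const (y := if v ∈ S.1 then (1 : ℂ) else 0)

theorem CharParam.continuous_edge (e : E) :
    Continuous fun p : Q.CharParam => p.edge e := by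
  refine continuous_sigma fun S => ?_
  by_cases h : Q.r e ∈ S.1 ∧ Q.s e ∈ S.1
  · simp only [CharParam.edge, dif_pos h]
    fun_prop
  · simp only [CharParam.edge, dif_neg h]
    exact continuous_const

/-- The one-dimensional representation with parameter `p`. -/
noncomputable def CharParam.rep (p : Q.CharParam) : Q.Rep where
  H := EuclideanSpace ℂ PUnit.{max u v + 1}
  P v := p.vertex v • 1
  T e := p.edge e • 1
  isStarProjection_P v := by
    unfold CharParam.vertex
    split_ifs
    · simp
    · simp
  norm_T_le e := by
    rw [norm_smul, norm_one, mul_one]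
    unfold CharParam.edge
    split_ifs with h
    · exact mem_closedBall_zero_iff.1 (p.2 ⟨e, h⟩).2
    · simp
  P_mul_T e := by
    unfold CharParam.edge CharParam.vertex
    split_ifs <;> simp_all
  T_mul_P e := by
    unfold CharParam.edge CharParam.vertex
    split_ifs <;> simp_all

/-- The functional `x ↦ ⟪ξ, π(x) ξ⟫` given by a representation `π` and a vector `ξ`. -/
noncomputable def Rep.vectorFunctional (π : Q.Rep) (ξ : π.H) : Q.Ambient →L[ℂ] ℂ :=
  LinearMap.mkContinuous
    { toFun := fun x => inner ℂ ξ (x π ξ)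
      map_add' := fun x y => by
        simp
      map_smul' := fun c x => by
        simp } (‖ξ‖ * ‖ξ‖) fun x => by
    calc ‖inner ℂ ξ (x π ξ)‖ ≤ ‖ξ‖ * ‖x π ξ‖ := norm_inner_le_norm _ _
      _ ≤ ‖ξ‖ * (‖x π‖ * ‖ξ‖) := by gcongr; exact (x π).le_opNorm ξ
      _ ≤ ‖ξ‖ * (‖x‖ * ‖ξ‖) := by gcongr; exact lp.norm_apply_le_norm ENNReal.top_ne_zero x π
      _ = ‖ξ‖ * ‖ξ‖ * ‖x‖ := by ring

theorem Rep.vectorFunctional_apply (π : Q.Rep) (ξ : π.H) (x : Q.Ambient) :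
    π.vectorFunctional ξ x = inner ℂ ξ (x π ξ) := rfl

theorem Rep.norm_vectorFunctional_apply_le (π : Q.Rep) {ξ : π.H} (hξ : ‖ξ‖ = 1) (x : Q.Ambient) :
    ‖π.vectorFunctional ξ x‖ ≤ ‖x‖ := by
  simpa [hξ] using (π.vectorFunctional ξ).le_of_opNorm_le
    (LinearMap.mkContinuous_norm_le _ (by positivity) _) x

/-- The hypothesis says that the space is the line spanned by `ξ`, so operators act as scalars. -/
theorem Rep.vectorFunctional_mul (π : Q.Rep) {ξ : π.H} (hξ : ∀ η, inner ℂ ξ η • ξ = η)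
    (x y : Q.Ambient) :
    π.vectorFunctional ξ (x * y) = π.vectorFunctional ξ x * π.vectorFunctional ξ y := by
  simp only [Rep.vectorFunctional_apply]
  have : (x * y) π ξ = x π (y π ξ) := rfl
  rw [this, ← hξ (y π ξ), map_smul, inner_smul_right, hξ, mul_comm]

theorem Rep.vectorFunctional_star (π : Q.Rep) (ξ : π.H) (x : Q.Ambient) :
    π.vectorFunctional ξ (star x) = star (π.vectorFunctional ξ x) := by
  simp only [Rep.vectorFunctional_apply]
  have : (star x) π ξ = ContinuousLinearMap.adjoint (x π) ξ := rfl
  rw [this, ContinuousLinearMap.adjoint_inner_right]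
  exact (inner_conj_symm _ _).symm

/-- The unit vector of the one-dimensional representation with parameter `p`. -/
noncomputable def CharParam.vec (p : Q.CharParam) : p.rep.H :=
  (EuclideanSpace.single PUnit.unit 1 : EuclideanSpace ℂ PUnit.{max u v + 1})

theorem CharParam.norm_vec (p : Q.CharParam) : ‖p.vec‖ = 1 := by
  change ‖(EuclideanSpace.single PUnit.unit 1 : EuclideanSpace ℂ PUnit.{max u v + 1})‖ = 1
  simp

theorem inner_single_smul_single (η : EuclideanSpace ℂ PUnit.{u + 1}) :
    inner ℂ (EuclideanSpace.single PUnit.unit 1 : EuclideanSpace ℂ PUnit.{u + 1}) η •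
      (EuclideanSpace.single PUnit.unit 1 : EuclideanSpace ℂ PUnit.{u + 1}) = η := by
  ext i
  simp [EuclideanSpace.inner_single_left]

theorem CharParam.inner_vec_smul_vec (p : Q.CharParam) (η : p.rep.H) :
    inner ℂ p.vec η • p.vec = η :=
  inner_single_smul_single η

/-- The character with parameter `p`, as a functional on bounded families of operators. -/
noncomputable def CharParam.eval (p : Q.CharParam) : Q.Ambient →L[ℂ] ℂ :=
  p.rep.vectorFunctional p.vec

theorem CharParam.eval_mul (p : Q.CharParam) (x y : Q.Ambient) :
    p.eval (x * y) = p.eval x * p.eval y :=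
  p.rep.vectorFunctional_mul p.inner_vec_smul_vec x y

theorem CharParam.eval_star (p : Q.CharParam) (x : Q.Ambient) :
    p.eval (star x) = star (p.eval x) :=
  p.rep.vectorFunctional_star p.vec x

theorem CharParam.norm_eval_le (p : Q.CharParam) (x : Q.Ambient) : ‖p.eval x‖ ≤ ‖x‖ :=
  p.rep.norm_vectorFunctional_apply_le p.norm_vec x

theorem CharParam.eval_univP (p : Q.CharParam) (v : V) : p.eval (Q.univP v) = p.vertex v := by
  have : p.eval (Q.univP v) = inner ℂ p.vec (p.vertex v • p.vec) := rfl
  rw [this, inner_smul_right, inner_self_eq_norm_sq_to_K, p.norm_vec]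
  simp

theorem CharParam.eval_univT (p : Q.CharParam) (e : E) : p.eval (Q.univT e) = p.edge e := by
  have : p.eval (Q.univT e) = inner ℂ p.vec (p.edge e • p.vec) := rfl
  rw [this, inner_smul_right, inner_self_eq_norm_sq_to_K, p.norm_vec]
  simp

/-- The functionals `p.eval` are contractive uniformly in `p`, so a norm limit in `x` is a uniform
limit of functions of `p`. -/
theorem isClosed_setOf_continuous_eval :
    IsClosed {x : Q.Ambient | Continuous fun p : Q.CharParam => p.eval x} := by
  refine isClosed_of_closure_subset fun x hx => ?_
  refine continuous_of_uniform_approx_of_continuous fun U hU => ?_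
  obtain ⟨ε, hε, h⟩ := Metric.mem_uniformity_dist.1 hU
  obtain ⟨y, hy, hxy⟩ := Metric.mem_closure_iff.1 hx ε hε
  refine ⟨_, hy, fun p => h ?_⟩
  rw [dist_eq_norm, ← map_sub]
  exact (p.norm_eval_le _).trans_lt (by rwa [dist_eq_norm] at hxy)

theorem continuous_eval_of_mem_GC {x : Q.Ambient} (hx : x ∈ Q.GC) :
    Continuous fun p : Q.CharParam => p.eval x := by
  let S : NonUnitalStarSubalgebra ℂ Q.Ambient :=
    { carrier := {x | Continuous fun p : Q.CharParam => p.eval x}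
      add_mem' := fun {x y} hx hy => by
        simp only [Set.mem_ofPred_eq, map_add] at *
        exact hx.add hy
      zero_mem' := by
        have h : (fun p : Q.CharParam => p.eval 0) = fun _ => 0 := funext fun p => p.eval.map_zero
        rw [Set.mem_ofPred_eq, h]
        exact continuous_const
      mul_mem' := fun {x y} hx hy => by
        simp only [Set.mem_ofPred_eq, CharParam.eval_mul] at *
        exact hx.mul hy
      smul_mem' := fun c x hx => by
        simp only [Set.mem_ofPred_eq, map_smul] at *
        exact hx.const_smul c
      star_mem' := fun {x} hx => by
        simp only [Set.mem_ofPred_eq, CharParam.eval_star] at *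
        exact hx.star }
  refine NonUnitalStarSubalgebra.topologicalClosure_minimal
    (NonUnitalStarAlgebra.adjoin ℂ (Set.range Q.univP ∪ Set.range Q.univT)) (t := S) ?_
    isClosed_setOf_continuous_eval hx
  refine NonUnitalStarAlgebra.adjoin_le ?_
  rintro _ (⟨v, rfl⟩ | ⟨e, rfl⟩)
  · change Continuous fun p : Q.CharParam => p.eval (Q.univP v)
    simp_rw [CharParam.eval_univP]
    exact CharParam.continuous_vertex v
  · change Continuous fun p : Q.CharParam => p.eval (Q.univT e)
    simp_rw [CharParam.eval_univT]
    exact CharParam.continuous_edge e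

/-! ### The maximal ideal spaces as disjoint unions of polydiscs -/

theorem OA_le_GC : Q.OA ≤ Q.GC.toNonUnitalSubalgebra := by
  refine NonUnitalSubalgebra.topologicalClosure_minimal ?_
    (NonUnitalStarSubalgebra.isClosed_topologicalClosure _)
  refine NonUnitalAlgebra.adjoin_le fun x hx => ?_
  exact NonUnitalStarSubalgebra.le_topologicalClosure _ (NonUnitalStarAlgebra.subset_adjoin ℂ _ hx)

theorem univP_mem_OA (v : V) : Q.univP v ∈ Q.OA :=
  NonUnitalSubalgebra.le_topologicalClosure _
    (NonUnitalAlgebra.subset_adjoin ℂ (.inl ⟨v, rfl⟩))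

theorem univT_mem_OA (e : E) : Q.univT e ∈ Q.OA :=
  NonUnitalSubalgebra.le_topologicalClosure _
    (NonUnitalAlgebra.subset_adjoin ℂ (.inr ⟨e, rfl⟩))

theorem univP_mul_self (v : V) : Q.univP v * Q.univP v = Q.univP v :=
  lp.ext (funext fun π => (π.isStarProjection_P v).isIdempotentElem)

theorem univP_mul_univT (e : E) : Q.univP (Q.r e) * Q.univT e = Q.univT e :=
  lp.ext (funext fun π => π.P_mul_T e)

theorem univT_mul_univP (e : E) : Q.univT e * Q.univP (Q.s e) = Q.univT e :=
  lp.ext (funext fun π => π.T_mul_P e)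

theorem norm_univT_le (e : E) : ‖Q.univT e‖ ≤ 1 :=
  lp.norm_le_of_forall_le zero_le_one fun π => π.norm_T_le e

/-- The powers of `a` stay in the unit ball, so the powers of `φ a` are bounded. Exponents start at
1 because there need not be a unit. -/
theorem norm_apply_le_one_of_map_mul {A : Type*} [NonUnitalNormedRing A] [NormedSpace ℂ A]
    {φ : A →L[ℂ] ℂ} (hφ : ∀ x y, φ (x * y) = φ x * φ y) {a : A} (ha : ‖a‖ ≤ 1) : ‖φ a‖ ≤ 1 := by
  by_contra! h
  have hpow (n : ℕ) : ∃ b, ‖b‖ ≤ 1 ∧ φ b = φ a ^ (n + 1) := by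
    induction n with
    | zero => exact ⟨a, ha, by simp⟩
    | succ n ih =>
      obtain ⟨b, hb, hφb⟩ := ih
      refine ⟨b * a, (norm_mul_le _ _).trans (mul_le_one₀ hb (norm_nonneg _) ha), ?_⟩
      rw [hφ, hφb, ← pow_succ]
  obtain ⟨n, hn⟩ := pow_unbounded_of_one_lt ‖φ‖ h
  obtain ⟨b, hb, hφb⟩ := hpow n
  have h1 : ‖φ a‖ ^ (n + 1) ≤ ‖φ‖ := by
    rw [← norm_pow, ← hφb]
    exact (φ.le_opNorm b).trans (mul_le_of_le_one_right (norm_nonneg _) hb)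
  have h2 : ‖φ a‖ ^ n ≤ ‖φ a‖ ^ (n + 1) := pow_le_pow_right₀ h.le n.le_succ
  linarith

variable {A : Type*} [NonUnitalNormedRing A] [NormedSpace ℂ A]

/-- The maximal ideal space of a closed algebra of bounded families between `OA(Q)` and `GC*_m(Q)`
is the disjoint union of polydiscs, provided that characters are determined by their values at
vertices and edges. -/
theorem nonempty_homeomorph_characterSpace [Finite V] (ι : A →L[ℂ] Q.Ambient)
    (hmul : ∀ x y, ι (x * y) = ι x * ι y) (hnorm : ∀ a, ‖ι a‖ = ‖a‖) (hGC : ∀ a, ι a ∈ Q.GC)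
    (hOA : ∀ x ∈ Q.OA, ∃ a, ι a = x)
    (hdet : ∀ φ ψ : A →L[ℂ] ℂ, (∀ x y, φ (x * y) = φ x * φ y) → (∀ x y, ψ (x * y) = ψ x * ψ y) →
      (∀ a v, ι a = Q.univP v → φ a = ψ a) → (∀ a e, ι a = Q.univT e → φ a = ψ a) → φ = ψ) :
    Nonempty (Q.CharParam ≃ₜ characterSpace ℂ A) := by
  classical
  have hinj : Function.Injective ι := (AddMonoidHomClass.isometry_of_norm ι hnorm).injective
  choose P hP using fun v => hOA _ (Q.univP_mem_OA v)
  choose T hT using fun e => hOA _ (Q.univT_mem_OA e)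
  let χ : Q.CharParam → A →L[ℂ] ℂ := fun p => p.eval.comp ι
  have hχP (p : Q.CharParam) (v : V) : χ p (P v) = p.vertex v := by
    simp [χ, hP, CharParam.eval_univP]
  have hχT (p : Q.CharParam) (e : E) : χ p (T e) = p.edge e := by
    simp [χ, hT, CharParam.eval_univT]
  have hχmul (p : Q.CharParam) (x y : A) : χ p (x * y) = χ p x * χ p y := by
    simp [χ, hmul, CharParam.eval_mul]
  let F : Q.CharParam → characterSpace ℂ A := fun p =>
    ⟨StrongDual.toWeakDual (χ p), by
      refine ⟨fun h => ?_, hχmul p⟩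
      obtain ⟨v, hv⟩ := p.1.2
      have h1 : χ p (P v) = 0 := DFunLike.congr_fun h (P v)
      simp [hχP, CharParam.vertex, hv] at h1⟩
  have hFapp (p : Q.CharParam) (a : A) : (F p : WeakDual ℂ A) a = χ p a := rfl
  have hFcont : Continuous F := by
    refine continuous_induced_rng.2 (WeakDual.continuous_of_continuous_eval fun a => ?_)
    exact continuous_eval_of_mem_GC (hGC a)
  have hFinj : Function.Injective F := fun p q h => by
    have h' (a : A) : χ p a = χ q a := by rw [← hFapp, h, hFapp]
    exact CharParam.ext_vertex_edge (fun v => by rw [← hχP, h', hχP])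
      (fun e => by rw [← hχT, h', hχT])
  have hFsurj : Function.Surjective F := by
    rintro ⟨φ, hφ0, hφ⟩
    let φ' : A →L[ℂ] ℂ := WeakDual.toStrongDual φ
    have hφ' : ∀ x y, φ' (x * y) = φ' x * φ' y := hφ
    have hPP (v : V) : φ' (P v) = 0 ∨ φ' (P v) = 1 := by
      have h1 : P v * P v = P v := hinj (by rw [hmul, hP, univP_mul_self])
      have h2 := hφ' (P v) (P v)
      rw [h1] at h2
      by_cases h0 : φ' (P v) = 0
      · exact .inl h0
      · exact .inr (mul_left_cancel₀ h0 (by rw [← h2, mul_one]))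
    have hr (e : E) : φ' (P (Q.r e)) * φ' (T e) = φ' (T e) := by
      rw [← hφ', hinj (by rw [hmul, hP, hT, univP_mul_univT] : ι (P (Q.r e) * T e) = ι (T e))]
    have hs (e : E) : φ' (T e) * φ' (P (Q.s e)) = φ' (T e) := by
      rw [← hφ', hinj (by rw [hmul, hP, hT, univT_mul_univP] : ι (T e * P (Q.s e)) = ι (T e))]
    have hTn (e : E) : ‖φ' (T e)‖ ≤ 1 :=
      norm_apply_le_one_of_map_mul hφ' (by rw [← hnorm, hT]; exact norm_univT_le e)
    cases nonempty_fintype V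
    let S : Finset V := Finset.univ.filter fun v => φ' (P v) = 1
    have hS (v : V) : v ∈ S ↔ φ' (P v) = 1 := by simp [S]
    have hS' (v : V) : v ∉ S ↔ φ' (P v) = 0 := by
      rw [hS]
      rcases hPP v with h | h <;> simp [h]
    have hTS (e : E) (h : ¬ (Q.r e ∈ S ∧ Q.s e ∈ S)) : φ' (T e) = 0 := by
      rcases not_and_or.1 h with h | h
      · rw [← hr, (hS' _).1 h, zero_mul]
      · rw [← hs, (hS' _).1 h, mul_zero]
    -- For empty `S` all generators would be sent to 0, and `φ` would agree with the zero
    -- functional.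
    have hSne : S.Nonempty := by
      by_contra hS0
      rw [Finset.not_nonempty_iff_eq_empty] at hS0
      refine hφ0 ((StrongDual.toWeakDual.apply_symm_apply φ).symm.trans ?_)
      have : φ' = 0 := by
        refine hdet φ' 0 hφ' (by simp) (fun a v ha => ?_) (fun a e ha => ?_)
        · obtain rfl : a = P v := hinj (ha.trans (hP v).symm)
          exact (hS' v).1 (by simp [hS0])
        · obtain rfl : a = T e := hinj (ha.trans (hT e).symm)
          exact hTS e (by simp [hS0])
      change StrongDual.toWeakDual φ' = 0
      rw [this, map_zero]
    let p : Q.CharParam :=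
      ⟨⟨S, hSne⟩, fun e => ⟨φ' (T e.1), mem_closedBall_zero_iff.2 (hTn e.1)⟩⟩
    have hp : χ p = φ' := by
      refine hdet _ _ (hχmul p) hφ' (fun a v ha => ?_) (fun a e ha => ?_)
      · obtain rfl : a = P v := hinj (ha.trans (hP v).symm)
        rw [hχP, CharParam.vertex]
        split_ifs with h
        · exact ((hS v).1 h).symm
        · exact ((hS' v).1 h).symm
      · obtain rfl : a = T e := hinj (ha.trans (hT e).symm)
        rw [hχT, CharParam.edge]
        split_ifs with h
        · rfl
        · exact (hTS e h).symm
    refine ⟨p, Subtype.ext ?_⟩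
    change StrongDual.toWeakDual (χ p) = φ
    rw [hp]
    exact StrongDual.toWeakDual.apply_symm_apply φ
  -- Finitely many products of closed discs form a compact space, so continuity of the inverse is
  -- automatic.
  exact ⟨hFcont.homeoOfEquivCompactToT2 (f := Equiv.ofBijective F ⟨hFinj, hFsurj⟩)⟩

/-- The functional extends to a unital character of the unitization, where characters of C⋆-algebras
preserve the involution. -/
theorem map_star_of_map_mul {A : Type*} [NonUnitalCStarAlgebra A] {φ : A →L[ℂ] ℂ}
    (hφ : ∀ x y, φ (x * y) = φ x * φ y) (a : A) : φ (star a) = star (φ a) := by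
  let f : A →ₙₐ[ℂ] ℂ :=
    { toFun := φ
      map_smul' := fun c x => map_smul φ c x
      map_zero' := map_zero φ
      map_add' := map_add φ
      map_mul' := hφ }
  have hf (x : A) : Unitization.lift f (Unitization.inr x) = φ x := by
    simp [Unitization.lift, f]
  have h := (AlgHomClass.instStarHomClass (F := Unitization ℂ A →ₐ[ℂ] ℂ)).map_star
    (Unitization.lift f) (Unitization.inr a)
  rwa [← Unitization.inr_star, hf, hf] at h

theorem eq_of_eqOn_adjoin {B : Type*} [NonUnitalNormedRing B] [NormedSpace ℂ B]
    [IsScalarTower ℂ B B] [SMulCommClass ℂ B B] {s : Set B}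
    {φ ψ : (NonUnitalAlgebra.adjoin ℂ s).topologicalClosure →L[ℂ] ℂ}
    (hφ : ∀ x y, φ (x * y) = φ x * φ y) (hψ : ∀ x y, ψ (x * y) = ψ x * ψ y)
    (h : ∀ a : (NonUnitalAlgebra.adjoin ℂ s).topologicalClosure, (a : B) ∈ s → φ a = ψ a) : φ = ψ := by
  have hle := (NonUnitalAlgebra.adjoin ℂ s).le_topologicalClosure
  have hd : DenseRange (Set.inclusion hle) := (denseRange_inclusion_iff hle).2 subset_rfl
  refine DFunLike.coe_injective (hd.equalizer φ.continuous ψ.continuous (funext ?_))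
  rintro ⟨x, hx⟩
  change φ ⟨x, hle hx⟩ = ψ ⟨x, hle hx⟩
  induction hx using NonUnitalAlgebra.adjoin_induction with
  | mem x hx => exact h _ hx
  | add x y hx hy ihx ihy =>
    exact (φ.map_add ⟨x, hle hx⟩ ⟨y, hle hy⟩).trans
      ((congrArg₂ _ ihx ihy).trans (ψ.map_add ⟨x, hle hx⟩ ⟨y, hle hy⟩).symm)
  | zero => exact φ.map_zero.trans ψ.map_zero.symm
  | mul x y hx hy ihx ihy =>
    exact (hφ ⟨x, hle hx⟩ ⟨y, hle hy⟩).trans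
      ((congrArg₂ _ ihx ihy).trans (hψ ⟨x, hle hx⟩ ⟨y, hle hy⟩).symm)
  | smul c x hx ih =>
    exact (φ.map_smul c ⟨x, hle hx⟩).trans
      ((congrArg _ ih).trans (ψ.map_smul c ⟨x, hle hx⟩).symm)

/-- Values at adjoints are determined as complex conjugates, so agreement on `s` suffices; this
needs the closure to be a C⋆-algebra. -/
theorem eq_of_eqOn_starAdjoin {B : Type*} [NonUnitalCStarAlgebra B] {s : Set B}
    {φ ψ : (NonUnitalStarAlgebra.adjoin ℂ s).topologicalClosure →L[ℂ] ℂ}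
    (hφ : ∀ x y, φ (x * y) = φ x * φ y) (hψ : ∀ x y, ψ (x * y) = ψ x * ψ y)
    (h : ∀ a : (NonUnitalStarAlgebra.adjoin ℂ s).topologicalClosure, (a : B) ∈ s → φ a = ψ a) : φ = ψ := by
  let _ : NonUnitalCStarAlgebra (NonUnitalStarAlgebra.adjoin ℂ s).topologicalClosure :=
    { norm_mul_self_le := fun x => CStarRing.norm_mul_self_le (x : B)
      toCompleteSpace :=
        (NonUnitalStarSubalgebra.isClosed_topologicalClosure _).completeSpace_coe }
  have hle := (NonUnitalStarAlgebra.adjoin ℂ s).le_topologicalClosure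
  have hd : DenseRange (Set.inclusion hle) := (denseRange_inclusion_iff hle).2 subset_rfl
  refine DFunLike.coe_injective (hd.equalizer φ.continuous ψ.continuous (funext ?_))
  rintro ⟨x, hx⟩
  change φ ⟨x, hle hx⟩ = ψ ⟨x, hle hx⟩
  induction hx using NonUnitalStarAlgebra.adjoin_induction with
  | mem x hx => exact h _ hx
  | add x y hx hy ihx ihy =>
    exact (φ.map_add ⟨x, hle hx⟩ ⟨y, hle hy⟩).trans
      ((congrArg₂ _ ihx ihy).trans (ψ.map_add ⟨x, hle hx⟩ ⟨y, hle hy⟩).symm)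
  | zero => exact φ.map_zero.trans ψ.map_zero.symm
  | mul x y hx hy ihx ihy =>
    exact (hφ ⟨x, hle hx⟩ ⟨y, hle hy⟩).trans
      ((congrArg₂ _ ihx ihy).trans (hψ ⟨x, hle hx⟩ ⟨y, hle hy⟩).symm)
  | smul c x hx ih =>
    exact (φ.map_smul c ⟨x, hle hx⟩).trans
      ((congrArg _ ih).trans (ψ.map_smul c ⟨x, hle hx⟩).symm)
  | star x hx ih =>
    exact (map_star_of_map_mul hφ ⟨x, hle hx⟩).trans
      ((congrArg _ ih).trans (map_star_of_map_mul hψ ⟨x, hle hx⟩).symm)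

variable (Q)

noncomputable instance : NormedSpace ℂ Q.OA where
  norm_smul_le c x := norm_smul_le c (x : Q.Ambient)

theorem nonempty_homeomorph_MOA [Finite V] : Nonempty (Q.CharParam ≃ₜ Q.MOA) := by
  let ι : Q.OA →L[ℂ] Q.Ambient :=
    ⟨⟨⟨Subtype.val, fun _ _ => rfl⟩, fun _ _ => rfl⟩, continuous_subtype_val⟩
  refine nonempty_homeomorph_characterSpace ι (fun _ _ => rfl)
    (fun _ => rfl) (fun a : Q.OA => OA_le_GC a.2)
    (fun x hx => ⟨(⟨x, hx⟩ : Q.OA), rfl⟩)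
    fun φ ψ hφ hψ hP hT => ?_
  refine eq_of_eqOn_adjoin hφ hψ ?_
  rintro a (⟨v, hv⟩ | ⟨e, he⟩)
  · exact hP a v hv.symm
  · exact hT a e he.symm

theorem nonempty_homeomorph_MGC [Finite V] : Nonempty (Q.CharParam ≃ₜ Q.MGC) := by
  let ι : Q.GC →L[ℂ] Q.Ambient :=
    ⟨⟨⟨Subtype.val, fun _ _ => rfl⟩, fun _ _ => rfl⟩, continuous_subtype_val⟩
  refine nonempty_homeomorph_characterSpace ι (fun _ _ => rfl)
    (fun _ => rfl) (fun a : Q.GC => a.2)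
    (fun x hx => ⟨(⟨x, OA_le_GC hx⟩ : Q.GC), rfl⟩)
    fun φ ψ hφ hψ hP hT => ?_
  refine eq_of_eqOn_starAdjoin hφ hψ ?_
  rintro a (⟨v, hv⟩ | ⟨e, he⟩)
  · exact hP a v hv.symm
  · exact hT a e he.symm
end DirGraph

/-! ### Connected components of the maximal ideal spaces -/

/-- The components of a disjoint union of connected spaces are its summands. -/
theorem exists_equiv_connectedComponents {ι M : Type*} {Y : ι → Type*}
    [∀ i, TopologicalSpace (Y i)] [∀ i, ConnectedSpace (Y i)] [TopologicalSpace M]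
    (e : (Σ i, Y i) ≃ₜ M) :
    ∃ c : ι ≃ ConnectedComponents M, ∀ i, Nonempty (componentSpace (c i) ≃ₜ Y i) := by
  -- For the discrete topology the index of a point is continuous, hence constant on components.
  let _ : TopologicalSpace ι := ⊥
  have : DiscreteTopology ι := ⟨rfl⟩
  have hf : Continuous fun x : M => (e.symm x).1 :=
    (continuous_sigma (f := Sigma.fst) fun i => continuous_const).comp e.symm.continuous
  have hmk (x y : M) : (ConnectedComponents.mk x = ConnectedComponents.mk y) ↔
      (e.symm x).1 = (e.symm y).1 := by
    constructor
    · intro h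
      have := congrArg hf.connectedComponentsLift h
      simpa using this
    · obtain ⟨⟨i, x⟩, rfl⟩ := e.surjective x
      obtain ⟨⟨j, y⟩, rfl⟩ := e.surjective y
      simp only [Homeomorph.symm_apply_apply]
      rintro rfl
      rw [ConnectedComponents.coe_eq_coe']
      exact (isPreconnected_range (e.continuous.comp continuous_sigmaMk)).subset_connectedComponent
        ⟨y, rfl⟩ ⟨x, rfl⟩
  let c : ι → ConnectedComponents M := fun i =>
    ConnectedComponents.mk (e ⟨i, Classical.arbitrary (Y i)⟩)
  have hc : Function.Bijective c := by
    constructor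
    · intro i j hij
      simpa using (hmk _ _).1 hij
    · intro C
      obtain ⟨x, rfl⟩ := ConnectedComponents.surjective_coe C
      exact ⟨(e.symm x).1, (hmk _ _).2 (by simp)⟩
  refine ⟨Equiv.ofBijective c hc, fun i => ?_⟩
  have hrange : (ConnectedComponents.mk ⁻¹' {Equiv.ofBijective c hc i} : Set M)
      = Set.range (e ∘ Sigma.mk i) := by
    ext x
    obtain ⟨⟨j, y⟩, rfl⟩ := e.surjective x
    simp only [Set.mem_preimage, Set.mem_singleton_iff, Equiv.ofBijective_apply, c, hmk,
      Homeomorph.symm_apply_apply, Set.mem_range, Function.comp_apply, e.injective.eq_iff]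
    constructor
    · rintro rfl
      exact ⟨y, rfl⟩
    · rintro ⟨z, hz⟩
      exact (congrArg Sigma.fst hz).symm
  exact ⟨(Homeomorph.setCongr hrange).trans
    (e.isEmbedding.comp Topology.IsEmbedding.sigmaMk).toHomeomorph.symm⟩

theorem card_nonempty_finset_add_one (W : Type*) [Fintype W] :
    Fintype.card {S : Finset W // S.Nonempty} + 1 = 2 ^ Fintype.card W := by
  classical
  have h : (Finset.univ.filter fun S : Finset W => S.Nonempty) = Finset.univ.erase ∅ := by
    ext S
    simp [Finset.nonempty_iff_ne_empty]
  rw [Fintype.card_subtype, h, Finset.card_erase_add_one (Finset.mem_univ _), Finset.card_univ,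
    Fintype.card_finset]

namespace DirGraph

variable {V : Type u} {E : Type v} (Q : DirGraph V E)

theorem exists_equiv_connectedComponents_polyDisc [Finite E] {M : Type*} [TopologicalSpace M]
    (e : Q.CharParam ≃ₜ M) :
    ∃ c : {S : Finset V // S.Nonempty} ≃ ConnectedComponents M,
      ∀ S (k : ℕ), Nonempty (componentSpace (c S) ≃ₜ PolyDisc k) ↔ k = Q.n S := by
  have : ConnectedSpace (Metric.closedBall (0 : ℂ) 1) :=
    isConnected_iff_connectedSpace.1
      ((convex_closedBall _ _).isConnected ⟨0, by simp⟩)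
  obtain ⟨c, hc⟩ := exists_equiv_connectedComponents e
  refine ⟨c, fun S k => ?_⟩
  obtain ⟨h⟩ := hc S
  let g : componentSpace (c S) ≃ₜ PolyDisc (Q.n S) :=
    h.trans (Homeomorph.piCongrLeft (Y := fun _ => Metric.closedBall (0 : ℂ) 1)
      (Finite.equivFin {e : E // Q.r e ∈ S.1 ∧ Q.s e ∈ S.1}))
  constructor
  · rintro ⟨f⟩
    exact PolyDisc.eq_of_homeomorph (f.symm.trans g)
  · rintro rfl
    exact ⟨g⟩

/-! ### Counting edges and recovering their numbers -/

section Count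

variable [Fintype E]

theorem numLoops_add_numNonLoops : Q.numLoops + Q.numNonLoops = Fintype.card E := by
  classical
  rw [numLoops, numNonLoops, Nat.card_eq_fintype_card, Nat.card_eq_fintype_card,
    Fintype.card_subtype_compl, Nat.add_sub_cancel' (Fintype.card_subtype_le _)]

variable [Fintype V]

/-- Double counting: the sets containing both ends of an edge form an interval of size $2^{n-1}$ for
a loop and $2^{n-2}$ otherwise. Integer exponents give the formula a meaning for $n < 2$ too. -/
theorem numLoops_mul_add_numNonLoops_mul :
    (Q.numLoops : ℚ) * 2 ^ ((Fintype.card V : ℤ) - 1)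
        + (Q.numNonLoops : ℚ) * 2 ^ ((Fintype.card V : ℤ) - 2)
      = ∑ S : {S : Finset V // S.Nonempty}, (Q.n S : ℚ) := by
  classical
  have hn (S : Finset V) :
      (Q.n S : ℚ) = ∑ e : E, if {Q.r e, Q.s e} ⊆ S then (1 : ℚ) else 0 := by
    rw [n, Nat.card_eq_fintype_card, Fintype.card_subtype, Finset.sum_boole]
    simp [Finset.insert_subset_iff]
  have h1 : ∑ S : {S : Finset V // S.Nonempty}, (Q.n S : ℚ) = ∑ S : Finset V, (Q.n S : ℚ) := by
    rw [← Finset.sum_subtype (Finset.univ.filter fun S : Finset V => S.Nonempty) (by simp)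
      (fun S => (Q.n S : ℚ))]
    refine Finset.sum_filter_of_ne fun S _ hS => ?_
    rw [Finset.nonempty_iff_ne_empty]
    rintro rfl
    simp [n] at hS
  have h2 (e : E) : (∑ S : Finset V, if {Q.r e, Q.s e} ⊆ S then (1 : ℚ) else 0)
      = if Q.s e = Q.r e then 2 ^ ((Fintype.card V : ℤ) - 1)
        else 2 ^ ((Fintype.card V : ℤ) - 2) := by
    have h3 : (Finset.univ.filter fun S : Finset V => {Q.r e, Q.s e} ⊆ S)
        = Finset.Icc {Q.r e, Q.s e} Finset.univ := by
      ext S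
      simp
    have hle := Finset.card_le_univ {Q.r e, Q.s e}
    rw [Finset.sum_boole, h3, Finset.card_Icc_finset (Finset.subset_univ _), Finset.card_univ,
      Nat.cast_pow, ← zpow_natCast, Nat.cast_sub hle]
    split_ifs with h
    · simp [h]
    · simp [Finset.card_pair (Ne.symm h)]
  rw [h1]
  simp_rw [hn]
  rw [Finset.sum_comm]
  simp_rw [h2]
  rw [Finset.sum_ite, Finset.sum_const, Finset.sum_const, nsmul_eq_mul, nsmul_eq_mul, numLoops,
    numNonLoops, Nat.card_eq_fintype_card, Nat.card_eq_fintype_card, Fintype.card_subtype,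
    Fintype.card_subtype]

theorem sup_n_eq_card :
    Finset.univ.sup (fun S : {S : Finset V // S.Nonempty} => Q.n S) = Fintype.card E := by
  classical
  refine le_antisymm (Finset.sup_le fun S _ => ?_) ?_
  · rw [n, Nat.card_eq_fintype_card]
    exact Fintype.card_subtype_le _
  · rcases isEmpty_or_nonempty E with hE | ⟨⟨e⟩⟩
    · simp
    · refine le_trans ?_ (Finset.le_sup (f := fun S : {S : Finset V // S.Nonempty} => Q.n S)
        (Finset.mem_univ ⟨Finset.univ, Q.r e, Finset.mem_univ _⟩))
      simp [n]

theorem eq_numLoops_and_eq_numNonLoops_iff (a b : ℕ) :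
    (a + b = Finset.univ.sup (fun S : {S : Finset V // S.Nonempty} => Q.n S) ∧
      (a : ℚ) * 2 ^ ((Fintype.card V : ℤ) - 1) + (b : ℚ) * 2 ^ ((Fintype.card V : ℤ) - 2)
        = ∑ S : {S : Finset V // S.Nonempty}, (Q.n S : ℚ)) ↔
      a = Q.numLoops ∧ b = Q.numNonLoops := by
  rw [← Q.numLoops_mul_add_numNonLoops_mul, sup_n_eq_card, ← Q.numLoops_add_numNonLoops]
  constructor
  · rintro ⟨h1, h2⟩
    have h3 : (2 : ℚ) ^ ((Fintype.card V : ℤ) - 1) = 2 * 2 ^ ((Fintype.card V : ℤ) - 2) := by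
      rw [← zpow_one_add₀ two_ne_zero]
      congr 1
      ring
    have h4 : (2 : ℚ) ^ ((Fintype.card V : ℤ) - 2) ≠ 0 := by positivity
    -- Dividing by $2^{n-2}$ leaves $2a + b$, which together with $a + b$ determines the pair.
    have h5 : (2 * a + b : ℚ) = 2 * Q.numLoops + Q.numNonLoops := by
      rw [h3] at h2
      refine mul_right_cancel₀ h4 ?_
      linarith
    norm_cast at h5
    omega
  · rintro ⟨rfl, rfl⟩
    exact ⟨rfl, rfl⟩

theorem numLoops_eq_and_numNonLoops_eq {V' : Type u'} {E' : Type v'} [Fintype V'] [Fintype E']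
    (Q' : DirGraph V' E') {M : Type*} [TopologicalSpace M]
    (e : Q.CharParam ≃ₜ M) (e' : Q'.CharParam ≃ₜ M) :
    Q.numLoops = Q'.numLoops ∧ Q.numNonLoops = Q'.numNonLoops := by
  obtain ⟨c, hc⟩ := Q.exists_equiv_connectedComponents_polyDisc e
  obtain ⟨c', hc'⟩ := Q'.exists_equiv_connectedComponents_polyDisc e'
  -- This matching of vertex sets comes from components alone; it preserves `n`, and neither
  -- inclusion nor cardinality of the sets is used.
  let σ := c.trans c'.symm
  have hσ (S : {S : Finset V // S.Nonempty}) : Q'.n (σ S) = Q.n S := by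
    refine (hc S _).1 ?_
    have h := (hc' (σ S) _).2 rfl
    rwa [show c' (σ S) = c S from c'.apply_symm_apply _] at h
  have hV : Fintype.card V = Fintype.card V' := by
    have h := Fintype.card_congr σ
    refine Nat.pow_right_injective le_rfl ?_
    change 2 ^ Fintype.card V = 2 ^ Fintype.card V'
    rw [← card_nonempty_finset_add_one, ← card_nonempty_finset_add_one, h]
  rw [← eq_numLoops_and_eq_numNonLoops_iff, ← hV]
  have h := (Q.eq_numLoops_and_eq_numNonLoops_iff _ _).2 ⟨rfl, rfl⟩
  refine ⟨h.1.trans ?_, h.2.trans ?_⟩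
  · refine le_antisymm (Finset.sup_le fun S _ => ?_) (Finset.sup_le fun S' _ => ?_)
    · rw [← hσ]
      exact Finset.le_sup (f := fun S' : {S : Finset V' // S.Nonempty} => Q'.n S')
        (Finset.mem_univ _)
    · rw [← σ.apply_symm_apply S', hσ]
      exact Finset.le_sup (f := fun S : {S : Finset V // S.Nonempty} => Q.n S)
        (Finset.mem_univ _)
  · exact Fintype.sum_equiv σ _ _ fun S => by rw [hσ]

end Count

end DirGraph

theorem proposition7 {V : Type u} {E : Type v} [Fintype V] [Fintype E] (Q : DirGraph V E) :
    -- the connected components of the two maximal ideal spaces correspond to the nonempty `S ⊆ V`,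
    -- and `n(S)` is the one number `k` such that the component of `S` is a `k`-dimensional polydisc
    (∃ c : {S : Finset V // S.Nonempty} ≃ ConnectedComponents Q.MOA,
      ∀ S (k : ℕ), Nonempty (componentSpace (c S) ≃ₜ PolyDisc k) ↔ k = Q.n S) ∧
    (∃ c : {S : Finset V // S.Nonempty} ≃ ConnectedComponents Q.MGC,
      ∀ S (k : ℕ), Nonempty (componentSpace (c S) ≃ₜ PolyDisc k) ↔ k = Q.n S) ∧
    -- the counting formula
    (Q.numLoops : ℚ) * 2 ^ ((Fintype.card V : ℤ) - 1)
        + (Q.numNonLoops : ℚ) * 2 ^ ((Fintype.card V : ℤ) - 2)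
      = ∑ S : {S : Finset V // S.Nonempty}, (Q.n S : ℚ) ∧
    -- together with the total number of edges, `max n(S)`, it has only one solution
    (∀ a b : ℕ,
      (a + b = Finset.univ.sup (fun S : {S : Finset V // S.Nonempty} => Q.n S) ∧
        (a : ℚ) * 2 ^ ((Fintype.card V : ℤ) - 1) + (b : ℚ) * 2 ^ ((Fintype.card V : ℤ) - 2)
          = ∑ S : {S : Finset V // S.Nonempty}, (Q.n S : ℚ)) ↔
      a = Q.numLoops ∧ b = Q.numNonLoops) ∧
    -- the numbers depend on the maximal ideal space alone, up to homeomorphism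
    (∀ {V' : Type u'} {E' : Type v'} [Fintype V'] [Fintype E'] (Q' : DirGraph V' E'),
      Nonempty (Q.MOA ≃ₜ Q'.MOA) →
        Q.numLoops = Q'.numLoops ∧ Q.numNonLoops = Q'.numNonLoops) ∧
    (∀ {V' : Type u'} {E' : Type v'} [Fintype V'] [Fintype E'] (Q' : DirGraph V' E'),
      Nonempty (Q.MGC ≃ₜ Q'.MGC) →
        Q.numLoops = Q'.numLoops ∧ Q.numNonLoops = Q'.numNonLoops) := by
  obtain ⟨eOA⟩ := Q.nonempty_homeomorph_MOA
  obtain ⟨eGC⟩ := Q.nonempty_homeomorph_MGC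
  refine ⟨Q.exists_equiv_connectedComponents_polyDisc eOA,
    Q.exists_equiv_connectedComponents_polyDisc eGC, Q.numLoops_mul_add_numNonLoops_mul,
    Q.eq_numLoops_and_eq_numNonLoops_iff, ?_, ?_⟩
  · rintro V' E' _ _ Q' ⟨h⟩
    obtain ⟨e'⟩ := Q'.nonempty_homeomorph_MOA
    exact Q.numLoops_eq_and_numNonLoops_eq Q' (eOA.trans h) e'
  · rintro V' E' _ _ Q' ⟨h⟩
    obtain ⟨e'⟩ := Q'.nonempty_homeomorph_MGC
    exact Q.numLoops_eq_and_numNonLoops_eq Q' (eGC.trans h) e'
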